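/- Let $\alpha>0$ and let $X_1,X_2,\dots$ be i.i.d. random variables with the Pareto distribution function $F(x)=1-x^{-\alpha}$, $x\ge 1$ (the null hypothesis $H_0$). For $n\ge 2$ put $$F_n(t)=\frac1n\sum_{i=1}^n \mathrm I\{X_i\le t\},\qquad M_n(t)=\binom n2^{-1}\sum_{1\le i<j\le n}\mathrm I\Big\{\max\Big(\frac{X_i}{X_j},\frac{X_j}{X_i}\Big)\le t\Big\},\qquad T_n=\int_1^\infty (M_n(t)-F_n(t))\,dF_n(t),$$ where the integral is over $[1,\infty)$. Let $$\Upsilon(x,y,z)=\tfrac13\mathrm I\{\max(\tfrac xy,\tfrac yx)\le z\}+\tfrac13\mathrm I\{\max(\tfrac xz,\tfrac zx)\le y\}+\tfrac13\mathrm I\{\max(\tfrac yz,\tfrac zy)\le x\}-\tfrac12,$$ let $U_n=\binom n3^{-1}\sum_{1\le i<j<k\le n}\Upsilon(X_i,X_j,X_k)$ for $n\ge 3$ be the $U$-statistic of degree $3$ with kernel $\Upsilon$, and let $\upsilon(s)=E\,\Upsilon(s,X_2,X_3)$, so that $\upsilon(X_1)=E(\Upsilon(X_1,X_2,X_3)\mid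 X_1)$ almost surely. Then: 1. $\upsilon(s)=\frac23\,\frac{\alpha\ln s}{s^{\alpha}}-\frac16$ for all $s\ge1$, $E\,\upsilon(X_1)=0$, and $$\sigma^2=\mathrm{Var}(\upsilon(X_1))=\int_1^\infty \upsilon^2(s)\,\alpha s^{-\alpha-1}\,ds=\frac5{972}>0,$$ so the kernel $\Upsilon$ is non-degenerate. 2. $T_n$ and $U_n$ are asymptotically equivalent: $\sqrt n\,(T_n-U_n)\to 0$ in probability as $n\to\infty$. 3. $\sqrt n\,T_n\to \mathcal N\big(0,\tfrac5{108}\big)$ in distribution as $n\to\infty$. -/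

import Mathlib

open MeasureTheory ProbabilityTheory Filter
open scoped ENNReal NNReal

noncomputable section

namespace ParetoTest

/-- The `0`-`1` valued indicator `I{max(x/y, y/x) ≤ z}`. -/
def ratioInd (x y z : ℝ) : ℝ := if max (x / y) (y / x) ≤ z then 1 else 0

/-- The empirical distribution function of the sample `x`. -/
def empCDF {n : ℕ} (x : Fin n → ℝ) (t : ℝ) : ℝ :=
  (n : ℝ)⁻¹ * ∑ i, (if x i ≤ t then (1 : ℝ) else 0)

/-- The measure `dFₙ`: mass `1/n` at each sample point, counted with multiplicity. -/
def empMeasure {n : ℕ} (x : Fin n → ℝ) : Measure ℝ :=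
  (n : ℝ≥0∞)⁻¹ • ∑ i, Measure.dirac (x i)

/-- The `U`-empirical distribution function of `max(X/Y, Y/X)` based on the sample `x`. -/
def ratioEmpCDF {n : ℕ} (x : Fin n → ℝ) (t : ℝ) : ℝ :=
  (n.choose 2 : ℝ)⁻¹ * ∑ i, ∑ j ∈ Finset.Ioi i, ratioInd (x i) (x j) t

/-- The integral-type statistic `∫₁^∞ (Mₙ(t) - Fₙ(t)) dFₙ(t)`. -/
def testStat {n : ℕ} (x : Fin n → ℝ) : ℝ :=
  ∫ t in Set.Ici 1, (ratioEmpCDF x t - empCDF x t) ∂(empMeasure x)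

/-- The symmetric kernel of degree three. -/
def kernel (x y z : ℝ) : ℝ :=
  1 / 3 * ratioInd x y z + 1 / 3 * ratioInd x z y + 1 / 3 * ratioInd y z x - 1 / 2

/-- The `U`-statistic of degree three with kernel `kernel`. -/
def uStat {n : ℕ} (x : Fin n → ℝ) : ℝ :=
  (n.choose 3 : ℝ)⁻¹ *
    ∑ i, ∑ j ∈ Finset.Ioi i, ∑ k ∈ Finset.Ioi j, kernel (x i) (x j) (x k)

/-- The projection `s ↦ E[kernel(s, Y, Z)]`, with `Y`, `Z` independent of law `μ`. -/
def projection (μ : Measure ℝ) (s : ℝ) : ℝ :=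
  ∫ p : ℝ × ℝ, kernel s p.1 p.2 ∂(μ.prod μ)

end ParetoTest

end

/-! The statistic differs from a bounded `U`-statistic by `O(1/n)`, and that `U`-statistic is
handled by its first-order Hoeffding projection.

Integrating against the empirical measure turns the test statistic into a sum over pairs `i < j` and
a further index `k`. Distinct indices give, after symmetrisation, the degree-three kernel plus
`1/2`; the coincidences `k = i` and `k = j` are of lower order. Almost surely there are no ties, so
the empirical distribution function integrated against itself is deterministic, `1/2 + O(1/n)`, and
cancels the shift. This gives the bound `3/n` of `abs_testStat_sub_uStat_le`.

Subtracting the three first-order projections from the kernel leaves a bounded residual whose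
integral over any two arguments vanishes. Two residual terms whose triples share at most one index
are therefore orthogonal, and only `O(n⁴)` pairs of triples remain. So the residual `U`-statistic
has second moment `O(n⁻²)`, negligible after scaling by `√n`
(`tendstoInMeasure_uStat_sub_projection`). What survives is a normalised sum of the iid variables
`3υ(X_k)`, to which the central limit theorem applies; Slutsky's lemma carries the limit over to
both statistics. The variance is `9 · 5/972 = 5/108`, from explicit Pareto integrals. -/

namespace ParetoTest

/-! ### Combinatorics of sums over pairs and triples of indices -/

section Sums

/-- The sum of `f i j` over `i < j < n`. -/
def sumPairs (n : ℕ) (f : ℕ → ℕ → ℝ) : ℝ := ∑ j ∈ Finset.range n, ∑ i ∈ Finset.range j, f i j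

/-- The sum of `f i j k` over `i < j < k < n`. -/
def sumTriples (n : ℕ) (f : ℕ → ℕ → ℕ → ℝ) : ℝ :=
  ∑ k ∈ Finset.range n, ∑ j ∈ Finset.range k, ∑ i ∈ Finset.range j, f i j k

/-- Taking the largest index as the outermost variable makes induction on `n` peel off exactly the
triples containing the new index. -/
lemma sumTriples_succ (n : ℕ) (f : ℕ → ℕ → ℕ → ℝ) :
    sumTriples (n + 1) f = sumTriples n f + sumPairs n (fun i j => f i j n) := by
  simp [sumTriples, sumPairs, Finset.sum_range_succ]

lemma sumPairs_succ (n : ℕ) (f : ℕ → ℕ → ℝ) :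
    sumPairs (n + 1) f = sumPairs n f + ∑ i ∈ Finset.range n, f i n := by
  simp [sumPairs, Finset.sum_range_succ]

lemma sumPairs_add (n : ℕ) (f g : ℕ → ℕ → ℝ) :
    sumPairs n (fun i j => f i j + g i j) = sumPairs n f + sumPairs n g := by
  simp [sumPairs, Finset.sum_add_distrib]

lemma sumTriples_add (n : ℕ) (f g : ℕ → ℕ → ℕ → ℝ) :
    sumTriples n (fun i j k => f i j k + g i j k) = sumTriples n f + sumTriples n g := by
  simp [sumTriples, Finset.sum_add_distrib]

lemma sumTriples_const_mul (n : ℕ) (c : ℝ) (f : ℕ → ℕ → ℕ → ℝ) :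
    sumTriples n (fun i j k => c * f i j k) = c * sumTriples n f := by
  simp [sumTriples, Finset.mul_sum]

lemma sumPairs_mono {n : ℕ} {f g : ℕ → ℕ → ℝ} (h : ∀ i j, i < j → j < n → f i j ≤ g i j) :
    sumPairs n f ≤ sumPairs n g :=
  Finset.sum_le_sum fun _ hj => Finset.sum_le_sum fun _ hi =>
    h _ _ (Finset.mem_range.1 hi) (Finset.mem_range.1 hj)

lemma sumTriples_mono {n : ℕ} {f g : ℕ → ℕ → ℕ → ℝ} (h : ∀ i j k, f i j k ≤ g i j k) :
    sumTriples n f ≤ sumTriples n g :=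
  Finset.sum_le_sum fun _ _ => Finset.sum_le_sum fun _ _ => Finset.sum_le_sum fun _ _ => h _ _ _

lemma sumPairs_const (n : ℕ) (c : ℝ) : sumPairs n (fun _ _ => c) = n.choose 2 * c := by
  induction n with
  | zero => simp [sumPairs]
  | succ n ih =>
    rw [sumPairs_succ, ih, Nat.choose_succ_succ' n 1]
    simp
    ring

lemma sumTriples_const (n : ℕ) (c : ℝ) : sumTriples n (fun _ _ _ => c) = n.choose 3 * c := by
  induction n with
  | zero => simp [sumTriples]
  | succ n ih =>
    rw [sumTriples_succ, ih, sumPairs_const, Nat.choose_succ_succ' n 2]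
    push_cast
    ring

lemma sumPairs_add_marginals (n : ℕ) (f : ℕ → ℝ) :
    sumPairs n (fun i j => f i + f j) = ((n : ℝ) - 1) * ∑ i ∈ Finset.range n, f i := by
  induction n with
  | zero => simp [sumPairs]
  | succ n ih =>
    rw [sumPairs_succ, ih, Finset.sum_add_distrib, Finset.sum_range_succ]
    simp
    ring

/-- Each index lies in `(n - 1)(n - 2)/2` of the triples. -/
lemma sumTriples_add_marginals (n : ℕ) (f : ℕ → ℝ) :
    sumTriples n (fun i j k => f i + f j + f k)
      = ((n : ℝ) - 1) * (n - 2) / 2 * ∑ i ∈ Finset.range n, f i := by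
  induction n with
  | zero => simp [sumTriples]
  | succ n ih =>
    rw [sumTriples_succ, ih, sumPairs_add, sumPairs_const, sumPairs_add_marginals,
      Finset.sum_range_succ, Nat.cast_choose_two]
    push_cast
    ring

/-- A sum over all ordered pairs, split along the diagonal. -/
lemma sum_range_sum_range (n : ℕ) (f : ℕ → ℕ → ℝ) :
    ∑ i ∈ Finset.range n, ∑ j ∈ Finset.range n, f i j
      = sumPairs n (fun i j => f i j + f j i) + ∑ i ∈ Finset.range n, f i i := by
  induction n with
  | zero => simp [sumPairs]
  | succ n ih =>
    rw [sumPairs_succ, Finset.sum_range_succ (fun i => f i i), Finset.sum_range_succ]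
    simp_rw [Finset.sum_range_succ _ n]
    rw [Finset.sum_add_distrib, ih, Finset.sum_add_distrib]
    ring

/-- A sum over a pair and a further index, split according to the position of that index. -/
lemma sum_range_sumPairs (n : ℕ) (f : ℕ → ℕ → ℕ → ℝ) :
    ∑ k ∈ Finset.range n, sumPairs n (fun i j => f i j k)
      = sumTriples n (fun i j k => f i j k + f i k j + f j k i)
        + sumPairs n (fun i j => f i j i + f i j j) := by
  induction n with
  | zero => simp [sumPairs, sumTriples]
  | succ n ih =>
    rw [Finset.sum_range_succ]
    simp_rw [sumPairs_succ]
    rw [Finset.sum_add_distrib, ih, sumTriples_succ, sum_range_sum_range]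
    simp_rw [sumPairs_add, Finset.sum_add_distrib]
    ring

lemma sum_fin_Ioi (n : ℕ) (i : Fin n) (f : ℕ → ℝ) :
    ∑ j ∈ Finset.Ioi i, f j = ∑ j ∈ Finset.range n, if (i : ℕ) < j then f j else 0 := by
  rw [← Fin.sum_univ_eq_sum_range (fun j => if (i : ℕ) < j then f j else 0),
    ← Finset.sum_filter]
  refine Finset.sum_congr ?_ fun _ _ => rfl
  ext j
  simp

lemma sum_range_ite_lt {n j : ℕ} (hj : j ≤ n) (f : ℕ → ℝ) :
    (∑ i ∈ Finset.range n, if i < j then f i else 0) = ∑ i ∈ Finset.range j, f i := by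
  rw [← Finset.sum_filter]
  refine Finset.sum_congr ?_ fun _ _ => rfl
  ext i
  simp only [Finset.mem_filter, Finset.mem_range]
  omega

lemma sum_fin_Ioi_eq_sumPairs (n : ℕ) (f : ℕ → ℕ → ℝ) :
    ∑ i : Fin n, ∑ j ∈ Finset.Ioi i, f i j = sumPairs n f := by
  rw [Finset.sum_congr rfl fun i _ => sum_fin_Ioi n i (f i),
    Fin.sum_univ_eq_sum_range (fun i => ∑ j ∈ Finset.range n, if i < j then f i j else 0),
    Finset.sum_comm]
  exact Finset.sum_congr rfl fun j hj =>
    sum_range_ite_lt (Finset.mem_range.1 hj).le (fun i => f i j)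

lemma sum_fin_Ioi_Ioi_eq_sumTriples (n : ℕ) (f : ℕ → ℕ → ℕ → ℝ) :
    ∑ i : Fin n, ∑ j ∈ Finset.Ioi i, ∑ k ∈ Finset.Ioi j, f i j k = sumTriples n f := by
  rw [Finset.sum_congr rfl fun (i : Fin n) _ => Finset.sum_congr rfl fun (j : Fin n) _ =>
      sum_fin_Ioi n j (f i j), sum_fin_Ioi_eq_sumPairs n
    (fun i j => ∑ k ∈ Finset.range n, if j < k then f i j k else 0)]
  unfold sumPairs sumTriples
  rw [Finset.sum_congr rfl fun j _ => Finset.sum_comm, Finset.sum_comm]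
  refine Finset.sum_congr rfl fun k hk => ?_
  rw [← sum_range_ite_lt (Finset.mem_range.1 hk).le]
  refine Finset.sum_congr rfl fun j _ => ?_
  split_ifs <;> simp

end Sums

lemma cast_choose_three (n : ℕ) : (n.choose 3 : ℝ) = n * (n - 1) * (n - 2) / 6 := by
  induction n with
  | zero => simp
  | succ n ih =>
    rw [Nat.choose_succ_succ' n 2, Nat.cast_add, ih, Nat.cast_choose_two]
    push_cast
    ring

/-! ### Pathwise comparison of the two statistics -/

section Deterministic

lemma ratioInd_nonneg (x y z : ℝ) : 0 ≤ ratioInd x y z := by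
  unfold ratioInd; split_ifs <;> simp

lemma ratioInd_le_one (x y z : ℝ) : ratioInd x y z ≤ 1 := by
  unfold ratioInd; split_ifs <;> simp

lemma ratioInd_comm (x y z : ℝ) : ratioInd x y z = ratioInd y x z := by
  simp [ratioInd, max_comm]

lemma kernel_swap_left (x y z : ℝ) : kernel x y z = kernel y x z := by
  simp only [kernel, ratioInd_comm x y]; ring

lemma kernel_swap_right (x y z : ℝ) : kernel x y z = kernel x z y := by
  simp only [kernel, ratioInd_comm y z]; ring

lemma abs_kernel_le (x y z : ℝ) : |kernel x y z| ≤ 1 / 2 := by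
  have h1 := ratioInd_nonneg x y z
  have h2 := ratioInd_nonneg x z y
  have h3 := ratioInd_nonneg y z x
  have h4 := ratioInd_le_one x y z
  have h5 := ratioInd_le_one x z y
  have h6 := ratioInd_le_one y z x
  rw [abs_le, kernel]
  constructor <;> linarith

@[fun_prop]
lemma measurable_ratioInd {β : Type*} [MeasurableSpace β] {f g h : β → ℝ} (hf : Measurable f)
    (hg : Measurable g) (hh : Measurable h) :
    Measurable (fun b => ratioInd (f b) (g b) (h b)) :=
  Measurable.ite (measurableSet_le ((hf.div hg).max (hg.div hf)) hh) measurable_const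
    measurable_const

@[fun_prop]
lemma measurable_kernel {β : Type*} [MeasurableSpace β] {f g h : β → ℝ} (hf : Measurable f)
    (hg : Measurable g) (hh : Measurable h) :
    Measurable (fun b => kernel (f b) (g b) (h b)) := by
  unfold kernel
  fun_prop

lemma uStat_eq (n : ℕ) (x : ℕ → ℝ) :
    uStat (fun i : Fin n => x i)
      = (n.choose 3 : ℝ)⁻¹ * sumTriples n (fun i j k => kernel (x i) (x j) (x k)) := by
  rw [uStat, sum_fin_Ioi_Ioi_eq_sumTriples n (fun i j k => kernel (x i) (x j) (x k))]

/-- All atoms of the empirical measure lie in `[1, ∞)`, so restricting the domain of integration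
loses nothing. -/
lemma testStat_eq {n : ℕ} {x : Fin n → ℝ} (hx : ∀ i, 1 ≤ x i) :
    testStat x = (n : ℝ)⁻¹ * ∑ k, (ratioEmpCDF x (x k) - empCDF x (x k)) := by
  have hres : (empMeasure x).restrict (Set.Ici 1) = empMeasure x := by
    refine Measure.restrict_eq_self_of_ae_mem ?_
    rw [ae_iff, empMeasure, Measure.smul_apply, Measure.coe_finsetSum, Finset.sum_apply,
      Finset.sum_eq_zero, smul_zero]
    intro i _
    rw [Measure.dirac_apply' _ (by exact measurableSet_Ici.compl)]
    simpa using hx i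
  rw [testStat, hres, empMeasure, integral_smul_measure, integral_finsetSum_measure]
  · simp
  · intro i _
    exact integrable_dirac (by simp)

lemma testStat_eq_sum {n : ℕ} {x : ℕ → ℝ} (hx : ∀ i, 1 ≤ x i) :
    testStat (fun i : Fin n => x i)
      = (n : ℝ)⁻¹ * ((n.choose 2 : ℝ)⁻¹ *
          ∑ k ∈ Finset.range n, sumPairs n (fun i j => ratioInd (x i) (x j) (x k))
        - (n : ℝ)⁻¹ * ∑ k ∈ Finset.range n, ∑ i ∈ Finset.range n,
          if x i ≤ x k then (1 : ℝ) else 0) := by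
  rw [testStat_eq fun i => hx i, Finset.sum_sub_distrib]
  unfold ratioEmpCDF empCDF
  rw [← Finset.mul_sum, ← Finset.mul_sum, Finset.sum_congr rfl fun k _ =>
      sum_fin_Ioi_eq_sumPairs n (fun i j => ratioInd (x i) (x j) (x (k : Fin n))),
    Finset.sum_congr rfl fun k _ => Fin.sum_univ_eq_sum_range
      (fun i => if x i ≤ x (k : Fin n) then (1 : ℝ) else 0) n,
    Fin.sum_univ_eq_sum_range (fun k => sumPairs n (fun i j => ratioInd (x i) (x j) (x k))),
    Fin.sum_univ_eq_sum_range
      (fun k => ∑ i ∈ Finset.range n, if x i ≤ x k then (1 : ℝ) else 0)]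

/-- Without ties, exactly one of the two comparisons holds for each pair, and each diagonal term
contributes one. -/
lemma sum_ite_le_of_injective (n : ℕ) {x : ℕ → ℝ} (hx : Function.Injective x) :
    (∑ k ∈ Finset.range n, ∑ i ∈ Finset.range n, if x i ≤ x k then (1 : ℝ) else 0)
      = n.choose 2 + n := by
  rw [sum_range_sum_range n (fun k i => if x i ≤ x k then (1 : ℝ) else 0)]
  have : sumPairs n (fun i j => (if x j ≤ x i then (1 : ℝ) else 0) + if x i ≤ x j then 1 else 0)
      = sumPairs n (fun _ _ => 1) := by
    refine Finset.sum_congr rfl fun j _ => Finset.sum_congr rfl fun i hi => ?_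
    have hij : x i ≠ x j := hx.ne (Finset.mem_range.1 hi).ne
    rcases lt_or_gt_of_ne hij with h | h <;> simp [h.le, h.not_ge]
  rw [this, sumPairs_const]
  simp

lemma abs_testStat_sub_uStat_le {n : ℕ} (hn : 3 ≤ n) {x : ℕ → ℝ} (hx : ∀ i, 1 ≤ x i)
    (hinj : Function.Injective x) :
    |testStat (fun i : Fin n => x i) - uStat (fun i : Fin n => x i)| ≤ 3 / n := by
  rw [testStat_eq_sum hx, uStat_eq, sum_ite_le_of_injective n hinj,
    sum_range_sumPairs n (fun i j k => ratioInd (x i) (x j) (x k))]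
  set S := sumTriples n (fun i j k => kernel (x i) (x j) (x k)) with hS
  set D := sumPairs n (fun i j => ratioInd (x i) (x j) (x i) + ratioInd (x i) (x j) (x j)) with hD
  have hn' : (3 : ℝ) ≤ n := by exact_mod_cast hn
  -- The three positions of the extra index reproduce the three terms of the kernel: `3 * kernel +
  -- 3/2`.
  have hsum : sumTriples n (fun i j k => ratioInd (x i) (x j) (x k) + ratioInd (x i) (x k) (x j)
      + ratioInd (x j) (x k) (x i)) = 3 * S + n.choose 3 * (3 / 2) := by
    rw [hS, ← sumTriples_const_mul, ← sumTriples_const, ← sumTriples_add]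
    congr 1
    funext i j k
    simp only [kernel]
    ring
  have hD0 : 0 ≤ D := by
    have := sumPairs_mono (n := n) (f := fun _ _ => 0)
      (g := fun i j => ratioInd (x i) (x j) (x i) + ratioInd (x i) (x j) (x j))
      fun i j _ _ => add_nonneg (ratioInd_nonneg _ _ _) (ratioInd_nonneg _ _ _)
    rwa [sumPairs_const, mul_zero] at this
  have hD1 : D ≤ n.choose 2 * 2 := by
    rw [← sumPairs_const]
    exact sumPairs_mono fun i j _ _ => by
      linarith [ratioInd_le_one (x i) (x j) (x i), ratioInd_le_one (x i) (x j) (x j)]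
  have hS0 : n.choose 3 * (-(1 / 2)) ≤ S := by
    rw [← sumTriples_const]
    exact sumTriples_mono fun i j k => (abs_le.1 (abs_kernel_le _ _ _)).1
  have hS1 : S ≤ n.choose 3 * (1 / 2) := by
    rw [← sumTriples_const]
    exact sumTriples_mono fun i j k => (abs_le.1 (abs_kernel_le _ _ _)).2
  have hc2 : (n.choose 2 : ℝ) = n * (n - 1) / 2 := Nat.cast_choose_two ℝ n
  have hc3 : (n.choose 3 : ℝ) = n.choose 2 * (n - 2) / 3 := by
    rw [cast_choose_three, hc2]
    ring
  have hpos2 : (0 : ℝ) < n.choose 2 := by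
    rw [hc2]; have : (0 : ℝ) < n - 1 := by linarith
    positivity
  have hpos3 : (0 : ℝ) < n.choose 3 := by
    rw [hc3]; have : (0 : ℝ) < n - 2 := by linarith
    positivity
  rw [hsum]
  have hSu : S = n.choose 3 * ((n.choose 3 : ℝ)⁻¹ * S) := by field_simp
  have hDu : D = n.choose 2 * ((n.choose 2 : ℝ)⁻¹ * D) := by field_simp
  set u := (n.choose 3 : ℝ)⁻¹ * S with hu
  set d := (n.choose 2 : ℝ)⁻¹ * D with hd
  rw [hSu] at hS0 hS1 ⊢
  rw [hDu] at hD0 hD1 ⊢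
  have hu0 := le_of_mul_le_mul_left hS0 hpos3
  have hu1 := le_of_mul_le_mul_left hS1 hpos3
  have hd0 : 0 ≤ d := nonneg_of_mul_nonneg_right hD0 hpos2
  have hd1 := le_of_mul_le_mul_left hD1 hpos2
  have hn0 : (n : ℝ) ≠ 0 := by positivity
  -- Since `C(n,3) = C(n,2)(n - 2)/3`, the leading terms cancel exactly. With `0 ≤ d ≤ 2` and `|u| ≤
  -- 1/2` the numerator lies in `[-5/2, 3/2]`.
  have key : (n : ℝ)⁻¹ * ((n.choose 2 : ℝ)⁻¹ * (3 * (n.choose 3 * u) + n.choose 3 * (3 / 2)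
      + n.choose 2 * d) - (n : ℝ)⁻¹ * (n.choose 2 + n)) - u
      = (d - 2 * u - 3 / 2) / n := by
    rw [hc3]
    have : (n.choose 2 : ℝ)⁻¹ * (3 * (n.choose 2 * (n - 2) / 3 * u)
      + n.choose 2 * (n - 2) / 3 * (3 / 2) + n.choose 2 * d) = (n - 2) * u + (n - 2) / 2 + d := by
      field_simp
    rw [this, hc2]
    field_simp
    ring
  rw [key, abs_div, Nat.abs_cast]
  gcongr
  rw [abs_le]
  constructor <;> linarith

end Deterministic

/-! ### Logarithmic power integrals on `(1, ∞)` -/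

section Integrals

open Asymptotics Topology

lemma tendsto_log_pow_mul_rpow_neg (k : ℕ) {c : ℝ} (hc : 0 < c) :
    Tendsto (fun s : ℝ => Real.log s ^ k * s ^ (-c)) atTop (𝓝 0) := by
  have h := (isLittleO_log_rpow_rpow_atTop (k : ℝ) hc).tendsto_div_nhds_zero
  refine h.congr' ?_
  filter_upwards [eventually_gt_atTop 0] with s hs
  rw [Real.rpow_natCast, Real.rpow_neg hs.le, div_eq_mul_inv]

lemma hasDerivAt_rpow_neg {c s : ℝ} (hs : 0 < s) :
    HasDerivAt (fun s : ℝ => s ^ (-c)) (-c * s ^ (-c - 1)) s :=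
  Real.hasDerivAt_rpow_const (Or.inl hs.ne')

lemma rpow_neg_eq_rpow_sub_one_mul {c s : ℝ} (hs : 0 < s) :
    s ^ (-c) = s ^ (-c - 1) * s := by
  rw [Real.rpow_sub_one hs.ne']; field_simp

lemma integral_log_rpow {c : ℝ} (hc : 0 < c) :
    IntegrableOn (fun s : ℝ => Real.log s * s ^ (-c - 1)) (Set.Ioi 1) ∧
      ∫ s in Set.Ioi (1 : ℝ), Real.log s * s ^ (-c - 1) = 1 / c ^ 2 := by
  -- Antiderivative from integration by parts; the factor `log s ^ 0` is kept so that one limit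
  -- lemma covers every term.
  have hderiv : ∀ s ∈ Set.Ici (1 : ℝ),
      HasDerivAt (fun s : ℝ => -(1 / c) * (Real.log s ^ 1 * s ^ (-c))
        - 1 / c ^ 2 * (Real.log s ^ 0 * s ^ (-c))) (Real.log s * s ^ (-c - 1)) s := by
    intro s hs
    have hs0 : 0 < s := lt_of_lt_of_le one_pos hs
    have h1 := Real.hasDerivAt_log hs0.ne'
    have h2 := hasDerivAt_rpow_neg (c := c) hs0
    refine ((((h1.pow 1).mul h2).const_mul _).sub (((h1.pow 0).mul h2).const_mul _)).congr_deriv ?_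
    rw [rpow_neg_eq_rpow_sub_one_mul hs0]
    simp
    field_simp
    ring
  have hnn : ∀ s ∈ Set.Ioi (1 : ℝ), 0 ≤ Real.log s * s ^ (-c - 1) := fun s hs =>
    mul_nonneg (Real.log_nonneg (le_of_lt hs)) (Real.rpow_nonneg (zero_le_one.trans (le_of_lt hs)) _)
  have hlim := ((tendsto_log_pow_mul_rpow_neg 1 hc).const_mul (-(1 / c))).sub
    ((tendsto_log_pow_mul_rpow_neg 0 hc).const_mul (1 / c ^ 2))
  refine ⟨integrableOn_Ioi_deriv_of_nonneg' hderiv hnn hlim, ?_⟩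
  rw [integral_Ioi_of_hasDerivAt_of_nonneg' hderiv hnn hlim]
  simp

lemma integral_log_sq_rpow {c : ℝ} (hc : 0 < c) :
    IntegrableOn (fun s : ℝ => Real.log s ^ 2 * s ^ (-c - 1)) (Set.Ioi 1) ∧
      ∫ s in Set.Ioi (1 : ℝ), Real.log s ^ 2 * s ^ (-c - 1) = 2 / c ^ 3 := by
  have hderiv : ∀ s ∈ Set.Ici (1 : ℝ),
      HasDerivAt (fun s : ℝ => -(1 / c) * (Real.log s ^ 2 * s ^ (-c))
        - 2 / c ^ 2 * (Real.log s ^ 1 * s ^ (-c)) - 2 / c ^ 3 * (Real.log s ^ 0 * s ^ (-c)))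
        (Real.log s ^ 2 * s ^ (-c - 1)) s := by
    intro s hs
    have hs0 : 0 < s := lt_of_lt_of_le one_pos hs
    have h1 := Real.hasDerivAt_log hs0.ne'
    have h2 := hasDerivAt_rpow_neg (c := c) hs0
    refine (((((h1.pow 2).mul h2).const_mul _).sub (((h1.pow 1).mul h2).const_mul _)).sub
      (((h1.pow 0).mul h2).const_mul _)).congr_deriv ?_
    rw [rpow_neg_eq_rpow_sub_one_mul hs0]
    simp
    field_simp
    ring
  have hnn : ∀ s ∈ Set.Ioi (1 : ℝ), 0 ≤ Real.log s ^ 2 * s ^ (-c - 1) := fun s hs =>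
    mul_nonneg (sq_nonneg _) (Real.rpow_nonneg (zero_le_one.trans (le_of_lt hs)) _)
  have hlim := (((tendsto_log_pow_mul_rpow_neg 2 hc).const_mul (-(1 / c))).sub
    ((tendsto_log_pow_mul_rpow_neg 1 hc).const_mul (2 / c ^ 2))).sub
    ((tendsto_log_pow_mul_rpow_neg 0 hc).const_mul (2 / c ^ 3))
  refine ⟨integrableOn_Ioi_deriv_of_nonneg' hderiv hnn hlim, ?_⟩
  rw [integral_Ioi_of_hasDerivAt_of_nonneg' hderiv hnn hlim]
  simp

lemma integral_rpow_Ioi {c s : ℝ} (hc : 0 < c) (hs : 0 < s) :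
    ∫ y in Set.Ioi s, y ^ (-c - 1) = s ^ (-c) / c := by
  rw [integral_Ioi_rpow_of_lt (by linarith) hs, sub_add_cancel, neg_div_neg_eq]

lemma integral_Ioi_one_split {s : ℝ} (hs : 1 ≤ s) {h f g : ℝ → ℝ}
    (hf : ∀ y ∈ Set.Ioc 1 s, h y = f y) (hg : ∀ y ∈ Set.Ioi s, h y = g y)
    (hfi : IntegrableOn f (Set.Ioc 1 s)) (hgi : IntegrableOn g (Set.Ioi s)) :
    ∫ y in Set.Ioi 1, h y = (∫ y in Set.Ioc 1 s, f y) + ∫ y in Set.Ioi s, g y := by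
  rw [← Set.Ioc_union_Ioi_eq_Ioi hs, setIntegral_union (Set.Ioc_disjoint_Ioi le_rfl)
    measurableSet_Ioi (hfi.congr_fun (fun y hy => (hf y hy).symm) measurableSet_Ioc)
    (hgi.congr_fun (fun y hy => (hg y hy).symm) measurableSet_Ioi),
    setIntegral_congr_fun measurableSet_Ioc hf, setIntegral_congr_fun measurableSet_Ioi hg]

end Integrals

/-! ### The projection and its moments under the Pareto law -/

section Pareto

variable {α : ℝ}

lemma integral_paretoMeasure (hα : 0 < α) (f : ℝ → ℝ) :
    ∫ x, f x ∂paretoMeasure 1 α = ∫ x in Set.Ioi 1, f x * (α * x ^ (-α - 1)) := by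
  have hm : Measurable (paretoPDF 1 α) := (measurable_paretoPDFReal 1 α).ennreal_ofReal
  rw [paretoMeasure, integral_withDensity_eq_integral_toReal_smul hm
    (ae_of_all _ fun x => ENNReal.ofReal_lt_top), ← integral_Ici_eq_integral_Ioi,
    ← integral_indicator measurableSet_Ici]
  refine integral_congr_ae (ae_of_all _ fun x => ?_)
  have h : (paretoPDF 1 α x).toReal = paretoPDFReal 1 α x :=
    ENNReal.toReal_ofReal (paretoPDFReal_nonneg zero_le_one hα.le x)
  simp only [h, paretoPDFReal, Set.indicator, Set.mem_Ici, Real.one_rpow, mul_one, neg_add']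
  split_ifs <;> simp [mul_comm]

instance instNullSingletonClassParetoMeasure (t r : ℝ) :
    NullSingletonClass (paretoMeasure t r) :=
  inferInstanceAs (NullSingletonClass (volume.withDensity (paretoPDF t r)))

lemma ae_one_le_paretoMeasure (α : ℝ) : ∀ᵐ x ∂paretoMeasure 1 α, 1 ≤ x := by
  rw [ae_iff, paretoMeasure]
  have : {x : ℝ | ¬ 1 ≤ x} = Set.Iio 1 := by ext; simp
  rw [this, withDensity_apply _ measurableSet_Iio]
  exact lintegral_paretoPDF_of_le le_rfl

lemma paretoMeasure_real_Ioi (hα : 0 < α) {c : ℝ} (hc : 1 ≤ c) :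
    (paretoMeasure 1 α).real (Set.Ioi c) = c ^ (-α) := by
  rw [← integral_indicator_one measurableSet_Ioi, integral_paretoMeasure hα]
  have : (fun x => (Set.Ioi c).indicator 1 x * (α * x ^ (-α - 1)))
      = (Set.Ioi c).indicator (fun x => α * x ^ (-α - 1)) := by
    funext x
    by_cases hx : x ∈ Set.Ioi c <;> simp [hx]
  rw [this, setIntegral_indicator measurableSet_Ioi,
    Set.inter_eq_right.2 (Set.Ioi_subset_Ioi hc), integral_const_mul,
    integral_rpow_Ioi hα (one_pos.trans_le hc)]
  field_simp

lemma paretoMeasure_real_Ici (hα : 0 < α) {c : ℝ} (hc : 1 ≤ c) :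
    (paretoMeasure 1 α).real (Set.Ici c) = c ^ (-α) := by
  rw [← paretoMeasure_real_Ioi hα hc]
  exact measureReal_congr Ioi_ae_eq_Ici.symm

lemma paretoMeasure_real_Icc (hα : 0 < α) {a b : ℝ} (ha : 1 ≤ a) (hab : a ≤ b) :
    (paretoMeasure 1 α).real (Set.Icc a b) = a ^ (-α) - b ^ (-α) := by
  have := isProbabilityMeasure_paretoMeasure (t := 1) one_pos hα
  rw [← paretoMeasure_real_Ici hα ha, ← paretoMeasure_real_Ioi hα (ha.trans hab),
    ← Set.Ici_sdiff_Ioi, measureReal_sdiff (Set.Ioi_subset_Ici hab) measurableSet_Ioi]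

lemma integral_ratioInd_last (hα : 0 < α) {x y : ℝ} (hx : 0 < x) (hy : 0 < y) :
    ∫ z, ratioInd x y z ∂paretoMeasure 1 α = max (x / y) (y / x) ^ (-α) := by
  have h1 : 1 ≤ max (x / y) (y / x) := by
    rcases le_total x y with h | h
    · exact le_max_of_le_right ((one_le_div hx).2 h)
    · exact le_max_of_le_left ((one_le_div hy).2 h)
  rw [← paretoMeasure_real_Ici hα h1, ← integral_indicator_one measurableSet_Ici]
  refine integral_congr_ae (ae_of_all _ fun z => ?_)
  simp [ratioInd, Set.indicator]

/-- For `z ≥ 1` the event says that `z` lies between `max (y / s) 1` and `s * y`, so this is an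
interval probability. -/
lemma integral_ratioInd_middle (hα : 0 < α) {s y : ℝ} (hs : 1 ≤ s) (hy : 1 ≤ y) :
    ∫ z, ratioInd y z s ∂paretoMeasure 1 α = max (y / s) 1 ^ (-α) - (s * y) ^ (-α) := by
  have hs0 : 0 < s := one_pos.trans_le hs
  have hy0 : 0 < y := one_pos.trans_le hy
  have hle : max (y / s) 1 ≤ s * y := by
    refine max_le ((div_le_self hy0.le hs).trans (le_mul_of_one_le_left hy0.le hs)) ?_
    nlinarith
  rw [← paretoMeasure_real_Icc hα (le_max_right _ _) hle,
    ← integral_indicator_one measurableSet_Icc]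
  refine integral_congr_ae ?_
  filter_upwards [ae_one_le_paretoMeasure α] with z hz
  have hz0 : 0 < z := one_pos.trans_le hz
  have : max (y / z) (z / y) ≤ s ↔ z ∈ Set.Icc (max (y / s) 1) (s * y) := by
    rw [max_le_iff, Set.mem_Icc, max_le_iff, div_le_iff₀ hz0, div_le_iff₀ hy0, div_le_iff₀ hs0,
      mul_comm z s]
    tauto
  simp only [ratioInd, this, Set.indicator, Pi.one_apply]

lemma integrable_ratioInd {β : Type*} [MeasurableSpace β] {ν : Measure β} [IsFiniteMeasure ν]
    {f g h : β → ℝ} (hf : Measurable f) (hg : Measurable g) (hh : Measurable h) :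
    Integrable (fun b => ratioInd (f b) (g b) (h b)) ν :=
  Integrable.of_bound (measurable_ratioInd hf hg hh).aestronglyMeasurable 1 (ae_of_all _ fun b => by
    rw [Real.norm_of_nonneg (ratioInd_nonneg _ _ _)]
    exact ratioInd_le_one _ _ _)

lemma integrableOn_rpow_Ioi {c s : ℝ} (hc : 0 < c) (hs : 0 < s) :
    IntegrableOn (fun y : ℝ => y ^ (-c - 1)) (Set.Ioi s) :=
  integrableOn_Ioi_rpow_of_lt (by linarith) hs

/-- The inner integral is a power of `max (s / y) (y / s)`, which switches branch at `y = s`. Below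
`s` the density turns it into a multiple of `1/y`, the source of the logarithm; above `s` it is a
pure power tail. -/
lemma integral_ratioInd_fix_first (hα : 0 < α) {s : ℝ} (hs : 1 ≤ s) :
    ∫ p : ℝ × ℝ, ratioInd s p.1 p.2 ∂((paretoMeasure 1 α).prod (paretoMeasure 1 α))
      = s ^ (-α) * (α * Real.log s) + s ^ (-α) / 2 := by
  have := isProbabilityMeasure_paretoMeasure (t := 1) one_pos hα
  have hs0 : 0 < s := one_pos.trans_le hs
  rw [integral_prod _ (integrable_ratioInd measurable_const measurable_fst measurable_snd)]
  have hinner : ∀ᵐ y ∂paretoMeasure 1 α, (∫ z, ratioInd s y z ∂paretoMeasure 1 α)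
      = max (s / y) (y / s) ^ (-α) := by
    filter_upwards [ae_one_le_paretoMeasure α] with y hy
    exact integral_ratioInd_last hα hs0 (one_pos.trans_le hy)
  rw [integral_congr_ae hinner, integral_paretoMeasure hα,
    integral_Ioi_one_split hs (f := fun y => s ^ (-α) * α * y⁻¹)
      (g := fun y => s ^ α * α * y ^ (-(2 * α) - 1)), integral_const_mul, integral_const_mul,
    integral_rpow_Ioi (by linarith) hs0, ← intervalIntegral.integral_of_le hs,
    integral_inv_of_pos one_pos hs0]
  · have : s ^ (-(2 * α)) = s ^ (-α) * s ^ (-α) := by rw [← Real.rpow_add hs0]; ring_nf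
    rw [this, div_one, Real.rpow_neg hs0.le]
    have := Real.rpow_pos_of_pos hs0 α
    field_simp
  · intro y hy
    have hy0 : 0 < y := one_pos.trans hy.1
    rw [max_eq_left (((div_le_one hs0).2 hy.2).trans ((one_le_div hy0).2 hy.2)),
      Real.div_rpow hs0.le hy0.le, Real.rpow_sub_one hy0.ne']
    have := Real.rpow_pos_of_pos hy0 (-α)
    field_simp
  · intro y hy
    have hy0 : 0 < y := hs0.trans hy
    have hsy : s ≤ y := le_of_lt hy
    rw [max_eq_right (((div_le_one hy0).2 hsy).trans ((one_le_div hs0).2 hsy)),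
      Real.div_rpow hy0.le hs0.le, Real.rpow_neg hs0.le,
      show -(2 * α) - 1 = -α + (-α - 1) by ring, Real.rpow_add hy0]
    have := Real.rpow_pos_of_pos hs0 α
    field_simp
  · have := (intervalIntegral.intervalIntegrable_inv (μ := volume) (f := fun y : ℝ => y)
      (a := 1) (b := s) (fun x hx => by
        rw [Set.uIcc_of_le hs] at hx; exact (one_pos.trans_le hx.1).ne') continuousOn_id)
    exact (((intervalIntegrable_iff_integrableOn_Ioc_of_le hs).1 this).const_mul _)
  · exact (integrableOn_rpow_Ioi (by linarith) hs0).const_mul _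

lemma integral_ratioInd_fix_last (hα : 0 < α) {s : ℝ} (hs : 1 ≤ s) :
    ∫ p : ℝ × ℝ, ratioInd p.1 p.2 s ∂((paretoMeasure 1 α).prod (paretoMeasure 1 α))
      = 1 - s ^ (-α) := by
  have := isProbabilityMeasure_paretoMeasure (t := 1) one_pos hα
  have hs0 : 0 < s := one_pos.trans_le hs
  rw [integral_prod _ (integrable_ratioInd measurable_fst measurable_snd measurable_const)]
  have hinner : ∀ᵐ y ∂paretoMeasure 1 α, (∫ z, ratioInd y z s ∂paretoMeasure 1 α)
      = max (y / s) 1 ^ (-α) - (s * y) ^ (-α) := by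
    filter_upwards [ae_one_le_paretoMeasure α] with y hy
    exact integral_ratioInd_middle hα hs hy
  have hsplit : ∀ y : ℝ, 0 < y →
      (s * y) ^ (-α) * (α * y ^ (-α - 1)) = s ^ (-α) * α * y ^ (-(2 * α) - 1) := by
    intro y hy0
    rw [Real.mul_rpow hs0.le hy0.le, show -(2 * α) - 1 = -α + (-α - 1) by ring,
      Real.rpow_add hy0]
    ring
  have hα1 := integrableOn_rpow_Ioi hα one_pos
  have hα2 := integrableOn_rpow_Ioi (c := 2 * α) (by linarith) one_pos
  have hα2s := integrableOn_rpow_Ioi (c := 2 * α) (by linarith) hs0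
  have hss : s ^ (-(2 * α)) = s ^ (-α) * s ^ (-α) := by rw [← Real.rpow_add hs0]; ring_nf
  have hIoc : ∫ y in Set.Ioc 1 s, y ^ (-α - 1) = (1 - s ^ (-α)) / α := by
    have h := setIntegral_union (Set.Ioc_disjoint_Ioi (a := 1) (le_refl s)) measurableSet_Ioi
      (hα1.mono_set Set.Ioc_subset_Ioi_self) (hα1.mono_set (Set.Ioi_subset_Ioi hs))
    rw [Set.Ioc_union_Ioi_eq_Ioi hs, integral_rpow_Ioi hα one_pos, integral_rpow_Ioi hα hs0,
      Real.one_rpow] at h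
    rw [sub_div]
    linarith
  rw [integral_congr_ae hinner, integral_paretoMeasure hα,
    integral_Ioi_one_split hs
      (f := fun y => α * y ^ (-α - 1) - s ^ (-α) * α * y ^ (-(2 * α) - 1))
      (g := fun y => s ^ α * α * y ^ (-(2 * α) - 1) - s ^ (-α) * α * y ^ (-(2 * α) - 1)),
    integral_sub, integral_sub, integral_const_mul, integral_const_mul, integral_const_mul,
    integral_const_mul, hIoc, integral_rpow_Ioi (c := 2 * α) (by linarith) hs0]
  · have h := setIntegral_union (Set.Ioc_disjoint_Ioi (a := 1) (le_refl s)) measurableSet_Ioi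
      (hα2.mono_set Set.Ioc_subset_Ioi_self) (hα2.mono_set (Set.Ioi_subset_Ioi hs))
    rw [Set.Ioc_union_Ioi_eq_Ioi hs, integral_rpow_Ioi (by linarith) one_pos,
      integral_rpow_Ioi (by linarith) hs0, Real.one_rpow] at h
    rw [eq_sub_of_add_eq h.symm, hss, Real.rpow_neg hs0.le]
    have := Real.rpow_pos_of_pos hs0 α
    field_simp
    ring
  · exact hα2s.const_mul _
  · exact hα2s.const_mul _
  · exact (hα1.mono_set Set.Ioc_subset_Ioi_self).const_mul _
  · exact (hα2.mono_set Set.Ioc_subset_Ioi_self).const_mul _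
  · intro y hy
    have hy0 : 0 < y := one_pos.trans hy.1
    rw [max_eq_right ((div_le_one hs0).2 hy.2), Real.one_rpow, sub_mul, hsplit y hy0, one_mul]
  · intro y hy
    have hy0 : 0 < y := hs0.trans hy
    rw [max_eq_left ((one_le_div hs0).2 (le_of_lt hy)), sub_mul, hsplit y hy0,
      Real.div_rpow hy0.le hs0.le, Real.rpow_neg hs0.le,
      show -(2 * α) - 1 = -α + (-α - 1) by ring, Real.rpow_add hy0]
    have := Real.rpow_pos_of_pos hs0 α
    field_simp
  · exact ((hα1.mono_set Set.Ioc_subset_Ioi_self).const_mul _).sub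
      ((hα2.mono_set Set.Ioc_subset_Ioi_self).const_mul _)
  · exact (hα2s.const_mul _).sub (hα2s.const_mul _)

/-- The pure `s ^ (-α)` terms cancel: two halves from the integrals with `s` in a ratio against
minus one from the integral with `s` as threshold. -/
lemma projection_paretoMeasure (hα : 0 < α) {s : ℝ} (hs : 1 ≤ s) :
    projection (paretoMeasure 1 α) s = 2 / 3 * (α * Real.log s / s ^ α) - 1 / 6 := by
  have := isProbabilityMeasure_paretoMeasure (t := 1) one_pos hα
  have i1 := integrable_ratioInd (ν := (paretoMeasure 1 α).prod (paretoMeasure 1 α))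
    (measurable_const (a := s)) measurable_fst measurable_snd
  have i2 := integrable_ratioInd (ν := (paretoMeasure 1 α).prod (paretoMeasure 1 α))
    (measurable_const (a := s)) measurable_snd measurable_fst
  have i3 := integrable_ratioInd (ν := (paretoMeasure 1 α).prod (paretoMeasure 1 α))
    measurable_fst measurable_snd (measurable_const (a := s))
  have hswap : ∫ p : ℝ × ℝ, ratioInd s p.2 p.1 ∂((paretoMeasure 1 α).prod (paretoMeasure 1 α))
      = s ^ (-α) * (α * Real.log s) + s ^ (-α) / 2 := by
    rw [← integral_ratioInd_fix_first hα hs, ← integral_prod_swap]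
    rfl
  unfold projection kernel
  rw [integral_sub (by exact ((i1.const_mul _).add (i2.const_mul _)).add (i3.const_mul _))
      (integrable_const _),
    integral_add (by exact (i1.const_mul _).add (i2.const_mul _)) (i3.const_mul _),
    integral_add (i1.const_mul _) (i2.const_mul _), integral_const_mul, integral_const_mul,
    integral_const_mul, integral_ratioInd_fix_first hα hs, hswap,
    integral_ratioInd_fix_last hα hs, Real.rpow_neg (zero_le_one.trans hs)]
  simp
  ring

lemma integral_projection (hα : 0 < α) :
    ∫ s, projection (paretoMeasure 1 α) s ∂paretoMeasure 1 α = 0 := by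
  have hlog := integral_log_rpow (c := 2 * α) (by linarith)
  rw [integral_paretoMeasure hα, setIntegral_congr_fun (g := fun s =>
    2 / 3 * α ^ 2 * (Real.log s * s ^ (-(2 * α) - 1)) - α / 6 * s ^ (-α - 1)) measurableSet_Ioi,
    integral_sub (hlog.1.const_mul _) ((integrableOn_rpow_Ioi hα one_pos).const_mul _),
    integral_const_mul, integral_const_mul, hlog.2, integral_rpow_Ioi hα one_pos, Real.one_rpow]
  · field_simp
    norm_num
  · intro s hs
    have hs0 : 0 < s := one_pos.trans hs
    simp only []
    rw [projection_paretoMeasure hα (le_of_lt hs), show -(2 * α) - 1 = -α + (-α - 1) by ring,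
      Real.rpow_add hs0, Real.rpow_neg hs0.le]
    ring

lemma integral_projection_sq (hα : 0 < α) :
    ∫ s in Set.Ioi (1 : ℝ), projection (paretoMeasure 1 α) s ^ 2 * (α * s ^ (-α - 1))
      = 5 / 972 := by
  have hlog := integral_log_rpow (c := 2 * α) (by linarith)
  have hlog2 := integral_log_sq_rpow (c := 3 * α) (by linarith)
  rw [setIntegral_congr_fun (g := fun s =>
    4 / 9 * α ^ 3 * (Real.log s ^ 2 * s ^ (-(3 * α) - 1))
      - 2 / 9 * α ^ 2 * (Real.log s * s ^ (-(2 * α) - 1)) + α / 36 * s ^ (-α - 1))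
    measurableSet_Ioi,
    integral_add (by exact (hlog2.1.const_mul _).sub (hlog.1.const_mul _))
      ((integrableOn_rpow_Ioi hα one_pos).const_mul _),
    integral_sub (hlog2.1.const_mul _) (hlog.1.const_mul _),
    integral_const_mul, integral_const_mul, integral_const_mul, hlog2.2, hlog.2,
    integral_rpow_Ioi hα one_pos, Real.one_rpow]
  · field_simp
    norm_num
  · intro s hs
    have hs0 : 0 < s := one_pos.trans hs
    simp only []
    rw [projection_paretoMeasure hα (le_of_lt hs), show -(2 * α) - 1 = -α + (-α - 1) by ring,
      show -(3 * α) - 1 = -α + (-α + (-α - 1)) by ring, Real.rpow_add hs0, Real.rpow_add hs0,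
      Real.rpow_neg hs0.le]
    ring

end Pareto

/-! ### Orthogonality and second moments of canonical kernels -/

section Hoeffding

variable {Ω : Type*} [MeasurableSpace Ω] {P : Measure Ω} [IsProbabilityMeasure P]
  {X : ℕ → Ω → ℝ} {μ : Measure ℝ}

lemma map_pair_eq_prod (hmeas : ∀ i, Measurable (X i)) (hlaw : ∀ i, P.map (X i) = μ)
    (hindep : iIndepFun X P) {b c : ℕ} (hbc : b ≠ c) :
    P.map (fun ω => (X b ω, X c ω)) = μ.prod μ := by
  rw [(hindep.indepFun hbc).map_prod_eq_prod_map_map (hmeas b).aemeasurable (hmeas c).aemeasurable,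
    hlaw, hlaw]

/-- Products of a canonical kernel integrate to zero as soon as two arguments of one factor
occur nowhere else. -/
lemma integral_mul_eq_zero_of_canonical [IsProbabilityMeasure μ] (hmeas : ∀ i, Measurable (X i))
    (hlaw : ∀ i, P.map (X i) = μ) (hindep : iIndepFun X P) {g : ℝ → ℝ → ℝ → ℝ} {C : ℝ}
    (hg : Measurable fun p : ℝ × ℝ × ℝ => g p.1 p.2.1 p.2.2) (hgC : ∀ x y z, |g x y z| ≤ C)
    (hg0 : ∀ x, ∫ p : ℝ × ℝ, g x p.1 p.2 ∂(μ.prod μ) = 0) (i j k a : ℕ) {b c : ℕ} (hbc : b ≠ c)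
    (hb : b ∉ ({i, j, k, a} : Finset ℕ)) (hc : c ∉ ({i, j, k, a} : Finset ℕ)) :
    ∫ ω, g (X i ω) (X j ω) (X k ω) * g (X a ω) (X b ω) (X c ω) ∂P = 0 := by
  set V : Ω → (ℝ × ℝ × ℝ) × ℝ := fun ω => ((X i ω, X j ω, X k ω), X a ω) with hV
  set W : Ω → ℝ × ℝ := fun ω => (X b ω, X c ω) with hW
  have hVm : Measurable V := by fun_prop
  have hWm : Measurable W := by fun_prop
  -- Only the blocks `{i, j, k, a}` and `{b, c}` must be disjoint; `a` may coincide with one of `i,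
  -- j, k`.
  have hVW : IndepFun V W P := by
    have hd : Disjoint ({i, j, k, a} : Finset ℕ) {b, c} := by
      simp only [Finset.disjoint_insert_right, Finset.disjoint_singleton_right]
      exact ⟨hb, hc⟩
    have h := hindep.indepFun_finset {i, j, k, a} {b, c} hd hmeas
    exact h.comp
      (φ := fun v : ({i, j, k, a} : Finset ℕ) → ℝ =>
        ((v ⟨i, by simp⟩, v ⟨j, by simp⟩, v ⟨k, by simp⟩), v ⟨a, by simp⟩))
      (ψ := fun w : ({b, c} : Finset ℕ) → ℝ => (w ⟨b, by simp⟩, w ⟨c, by simp⟩)) (by fun_prop) (by fun_prop)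
  have hmap := hVW.map_prod_eq_prod_map_map hVm.aemeasurable hWm.aemeasurable
  rw [map_pair_eq_prod hmeas hlaw hindep hbc] at hmap
  set F : ((ℝ × ℝ × ℝ) × ℝ) × (ℝ × ℝ) → ℝ :=
    fun q => g q.1.1.1 q.1.1.2.1 q.1.1.2.2 * g q.1.2 q.2.1 q.2.2 with hF
  have hFm : Measurable F :=
    (hg.comp (measurable_fst.comp measurable_fst)).mul
      (hg.comp (f := fun q : ((ℝ × ℝ × ℝ) × ℝ) × (ℝ × ℝ) => (q.1.2, q.2.1, q.2.2)) (by fun_prop))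
  have := Measure.isProbabilityMeasure_map (μ := P) hVm.aemeasurable
  have hFi : Integrable F ((P.map V).prod (μ.prod μ)) :=
    Integrable.of_bound hFm.aestronglyMeasurable (C * C) (ae_of_all _ fun q => by
      rw [Real.norm_eq_abs, abs_mul]
      exact mul_le_mul (hgC _ _ _) (hgC _ _ _) (abs_nonneg _) ((abs_nonneg _).trans (hgC 0 0 0)))
  calc ∫ ω, g (X i ω) (X j ω) (X k ω) * g (X a ω) (X b ω) (X c ω) ∂P
      = ∫ q, F q ∂(P.map fun ω => (V ω, W ω)) :=
        (integral_map (hVm.prodMk hWm).aemeasurable hFm.aestronglyMeasurable).symm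
    _ = 0 := by
        rw [hmap, integral_prod _ hFi]
        simp only [hF]
        simp_rw [integral_const_mul, hg0]
        simp

/-- The second moment of a sum of bounded variables most of whose products are centred. -/
lemma integral_sq_sum_le {ι : Type*} [DecidableEq ι] (T : Finset ι) (Z : ι → Ω → ℝ)
    {C : ℝ} (hZ : ∀ t, Measurable (Z t)) (hZC : ∀ t ω, |Z t ω| ≤ C) (B : ι → Finset ι) (m : ℕ)
    (hB : ∀ t ∈ T, (B t).card ≤ m)
    (h0 : ∀ t ∈ T, ∀ t' ∈ T, t' ∉ B t → ∫ ω, Z t ω * Z t' ω ∂P = 0) :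
    ∫ ω, (∑ t ∈ T, Z t ω) ^ 2 ∂P ≤ T.card * (m * C ^ 2) := by
  have hbound : ∀ t t' ω, ‖Z t ω * Z t' ω‖ ≤ C ^ 2 := fun t t' ω => by
    rw [Real.norm_eq_abs, abs_mul, sq]
    exact mul_le_mul (hZC _ _) (hZC _ _) (abs_nonneg _) ((abs_nonneg _).trans (hZC t ω))
  have hint : ∀ t t', Integrable (fun ω => Z t ω * Z t' ω) P := fun t t' =>
    Integrable.of_bound ((hZ t).mul (hZ t')).aestronglyMeasurable (C ^ 2)
      (ae_of_all _ (hbound t t'))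
  simp_rw [sq (∑ t ∈ T, Z t _), Finset.sum_mul_sum]
  rw [integral_finsetSum _ fun t _ => integrable_finsetSum _ fun t' _ => hint t t',
    ← nsmul_eq_mul]
  refine Finset.sum_le_card_nsmul _ _ _ fun t ht => ?_
  rw [integral_finsetSum _ fun t' _ => hint t t']
  calc ∑ t' ∈ T, ∫ ω, Z t ω * Z t' ω ∂P
      ≤ ∑ t' ∈ T, if t' ∈ B t then C ^ 2 else 0 := by
        refine Finset.sum_le_sum fun t' ht' => ?_
        split_ifs with h
        · refine (le_abs_self _).trans ?_
          have := norm_integral_le_of_norm_le_const (μ := P) (ae_of_all _ (hbound t t'))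
          simpa using this
        · exact (h0 t ht t' ht' h).le
    _ = ∑ t' ∈ T.filter (· ∈ B t), C ^ 2 := (Finset.sum_filter _ _).symm
    _ ≤ ∑ t' ∈ B t, C ^ 2 := Finset.sum_le_sum_of_subset_of_nonneg
        (fun t' h => (Finset.mem_filter.1 h).2) fun _ _ _ => sq_nonneg C
    _ ≤ m * C ^ 2 := by
        rw [Finset.sum_const, nsmul_eq_mul]
        have := hB t ht
        gcongr

/-- The decreasing triples below `n`. -/
def triples (n : ℕ) : Finset (Σ _ : ℕ, Σ _ : ℕ, ℕ) :=
  (Finset.range n).sigma fun k => (Finset.range k).sigma fun j => Finset.range j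

lemma sumTriples_eq_sum_triples (n : ℕ) (f : ℕ → ℕ → ℕ → ℝ) :
    sumTriples n f = ∑ t ∈ triples n, f t.2.2 t.2.1 t.1 := by
  simp [sumTriples, triples, Finset.sum_sigma]

lemma card_triples (n : ℕ) : ((triples n).card : ℝ) = n.choose 3 := by
  have h := sumTriples_const n 1
  rw [sumTriples_eq_sum_triples] at h
  simpa using h

/-- The triples below `n` with at least two entries in `s`. -/
def meetingTriples (n : ℕ) (s : Finset ℕ) : Finset (Σ _ : ℕ, Σ _ : ℕ, ℕ) :=
  (s ×ˢ s ×ˢ Finset.range n).image (fun p => ⟨p.1, p.2.1, p.2.2⟩) ∪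
  (s ×ˢ s ×ˢ Finset.range n).image (fun p => ⟨p.1, p.2.2, p.2.1⟩) ∪
  (s ×ˢ s ×ˢ Finset.range n).image (fun p => ⟨p.2.2, p.1, p.2.1⟩)

/-- Three choices of the free position, at most nine pairs of entries from `s`, and `n` values for
the free entry. -/
lemma card_meetingTriples_le (n : ℕ) {s : Finset ℕ} (hs : s.card ≤ 3) :
    (meetingTriples n s).card ≤ 27 * n := by
  have h : (s ×ˢ s ×ˢ Finset.range n).card ≤ 9 * n := by
    rw [Finset.card_product, Finset.card_product, Finset.card_range]
    calc s.card * (s.card * n) ≤ 3 * (3 * n) := by gcongr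
      _ = 9 * n := by ring
  refine (Finset.card_union_le _ _).trans ?_
  have h12 := Finset.card_union_le
    ((s ×ˢ s ×ˢ Finset.range n).image
      (fun p => (⟨p.1, p.2.1, p.2.2⟩ : Σ _ : ℕ, Σ _ : ℕ, ℕ)))
    ((s ×ˢ s ×ˢ Finset.range n).image (fun p => ⟨p.1, p.2.2, p.2.1⟩))
  have h1 := (Finset.card_image_le (s := s ×ˢ s ×ˢ Finset.range n)
    (f := fun p => (⟨p.1, p.2.1, p.2.2⟩ : Σ _ : ℕ, Σ _ : ℕ, ℕ))).trans h
  have h2 := (Finset.card_image_le (s := s ×ˢ s ×ˢ Finset.range n)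
    (f := fun p => (⟨p.1, p.2.2, p.2.1⟩ : Σ _ : ℕ, Σ _ : ℕ, ℕ))).trans h
  have h3 := (Finset.card_image_le (s := s ×ˢ s ×ˢ Finset.range n)
    (f := fun p => (⟨p.2.2, p.1, p.2.1⟩ : Σ _ : ℕ, Σ _ : ℕ, ℕ))).trans h
  omega

lemma mem_meetingTriples {n : ℕ} {s : Finset ℕ} {i j k : ℕ} (hi : i < n) (hj : j < n)
    (hk : k < n) (h : (k ∈ s ∧ j ∈ s) ∨ (k ∈ s ∧ i ∈ s) ∨ (j ∈ s ∧ i ∈ s)) :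
    (⟨k, j, i⟩ : Σ _ : ℕ, Σ _ : ℕ, ℕ) ∈ meetingTriples n s := by
  simp only [meetingTriples, Finset.mem_union, Finset.mem_image, Finset.mem_product,
    Finset.mem_range]
  rcases h with h | h | h
  · exact Or.inl (Or.inl ⟨(k, j, i), ⟨h.1, h.2, hi⟩, rfl⟩)
  · exact Or.inl (Or.inr ⟨(k, i, j), ⟨h.1, h.2, hj⟩, rfl⟩)
  · exact Or.inr ⟨(j, i, k), ⟨h.1, h.2, hk⟩, rfl⟩

/-- The second moment of an unnormalised canonical `U`-statistic of degree three. -/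
lemma integral_sq_sumTriples_le [IsProbabilityMeasure μ] (hmeas : ∀ i, Measurable (X i))
    (hlaw : ∀ i, P.map (X i) = μ) (hindep : iIndepFun X P) {g : ℝ → ℝ → ℝ → ℝ} {C : ℝ}
    (hg : Measurable fun p : ℝ × ℝ × ℝ => g p.1 p.2.1 p.2.2) (hgC : ∀ x y z, |g x y z| ≤ C)
    (hg0 : ∀ x, ∫ p : ℝ × ℝ, g x p.1 p.2 ∂(μ.prod μ) = 0)
    (hsl : ∀ x y z, g x y z = g y x z) (hsr : ∀ x y z, g x y z = g x z y) (n : ℕ) :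
    ∫ ω, (sumTriples n fun i j k => g (X i ω) (X j ω) (X k ω)) ^ 2 ∂P
      ≤ n.choose 3 * (27 * n * C ^ 2) := by
  simp_rw [sumTriples_eq_sum_triples]
  refine (integral_sq_sum_le (triples n)
    (fun t ω => g (X t.2.2 ω) (X t.2.1 ω) (X t.1 ω)) (C := C) ?_ (fun t ω => hgC _ _ _)
    (fun t => meetingTriples n {t.2.2, t.2.1, t.1}) (27 * n)
    (fun t _ => card_meetingTriples_le n Finset.card_le_three) ?_).trans ?_
  · exact fun t => hg.comp ((hmeas _).prodMk ((hmeas _).prodMk (hmeas _)))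
  · rintro ⟨k, j, i⟩ ht ⟨c, b, a⟩ ht' hB
    simp only [triples, Finset.mem_sigma, Finset.mem_range] at ht'
    obtain ⟨hcn, hbc, hab⟩ := ht'
    have hnot := mt (mem_meetingTriples (i := a) (j := b) (k := c) (by omega) (by omega) hcn) hB
    simp only [not_or, not_and] at hnot
    obtain ⟨h1, h2, h3⟩ := hnot
    simp only [Finset.mem_insert, Finset.mem_singleton] at h1 h2 h3
    simp only
    -- At most one of `a, b, c` is shared with the other triple. Symmetry of `g` moves the shared
    -- index, if any, to the first slot, leaving two fresh arguments to integrate out.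
    by_cases hc : c ∈ ({i, j, k} : Finset ℕ)
    · have key := integral_mul_eq_zero_of_canonical hmeas hlaw hindep hg hgC hg0 i j k c
        (b := a) (c := b) hab.ne (by simp at hc ⊢; grind) (by simp at hc ⊢; grind)
      simpa only [hsr (X a _) (X b _) (X c _), hsl (X a _) (X c _) (X b _)] using key
    · by_cases hb : b ∈ ({i, j, k} : Finset ℕ)
      · have key := integral_mul_eq_zero_of_canonical hmeas hlaw hindep hg hgC hg0 i j k b
          (b := a) (c := c) (hab.trans hbc).ne (by simp at hb hc ⊢; grind)
          (by simp at hb hc ⊢; grind)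
        simpa only [hsl (X a _) (X b _) (X c _)] using key
      · exact integral_mul_eq_zero_of_canonical hmeas hlaw hindep hg hgC hg0 i j k a
          hbc.ne (by simp at hb hc ⊢; grind) (by simp at hb hc ⊢; grind)
  · rw [card_triples]
    push_cast
    exact le_rfl

end Hoeffding

/-! ### Criteria for convergence in probability to zero -/

section Convergence

variable {Ω : Type*} [MeasurableSpace Ω] {P : Measure Ω} [IsProbabilityMeasure P]

/-- Chebyshev's inequality. -/
lemma tendstoInMeasure_zero_of_integral_sq {f : ℕ → Ω → ℝ} {u : ℕ → ℝ}
    (hf : ∀ᶠ n in atTop, Integrable (fun ω => f n ω ^ 2) P) (hu : Tendsto u atTop (nhds 0))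
    (hle : ∀ᶠ n in atTop, ∫ ω, f n ω ^ 2 ∂P ≤ u n) :
    TendstoInMeasure P f atTop (fun _ => (0 : ℝ)) := by
  rw [tendstoInMeasure_iff_measureReal_norm]
  intro ε hε
  have hu' : Tendsto (fun n => (ε ^ 2)⁻¹ * u n) atTop (nhds 0) := by
    simpa using hu.const_mul (ε ^ 2)⁻¹
  refine squeeze_zero' (Eventually.of_forall fun n => measureReal_nonneg) ?_ hu'
  filter_upwards [hf, hle] with n hfn hn
  have h := mul_meas_ge_le_integral_of_nonneg (μ := P) (ae_of_all _ fun ω => sq_nonneg (f n ω))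
    hfn (ε ^ 2)
  have hset : {ω | ε ≤ ‖f n ω - 0‖} ⊆ {ω | ε ^ 2 ≤ f n ω ^ 2} := by
    intro ω hω
    simp only [sub_zero, Real.norm_eq_abs, Set.mem_ofPred_eq] at hω ⊢
    rw [← sq_abs (f n ω)]
    gcongr
  rw [le_inv_mul_iff₀ (by positivity)]
  exact (mul_le_mul_of_nonneg_left (measureReal_mono hset) (by positivity)).trans (h.trans hn)

lemma tendstoInMeasure_zero_of_abs_le {f : ℕ → Ω → ℝ} {u : ℕ → ℝ}
    (hu : Tendsto u atTop (nhds 0)) (hle : ∀ᶠ n in atTop, ∀ᵐ ω ∂P, |f n ω| ≤ u n) :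
    TendstoInMeasure P f atTop (fun _ => (0 : ℝ)) := by
  rw [tendstoInMeasure_iff_measureReal_norm]
  intro ε hε
  refine tendsto_const_nhds.congr' ?_
  filter_upwards [hle, hu.eventually_lt_const hε] with n hn hun
  symm
  rw [measureReal_eq_zero_iff, ← compl_compl {ω | _}]
  filter_upwards [hn] with ω hω
  simpa using hω.trans_lt hun

end Convergence

/-! ### The first-order projection and the residual kernel -/

section Projection

variable {μ : Measure ℝ} [IsProbabilityMeasure μ]

lemma integrable_kernel {β : Type*} [MeasurableSpace β] {ν : Measure β} [IsFiniteMeasure ν]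
    {f g h : β → ℝ} (hf : Measurable f) (hg : Measurable g) (hh : Measurable h) :
    Integrable (fun b => kernel (f b) (g b) (h b)) ν :=
  Integrable.of_bound (measurable_kernel hf hg hh).aestronglyMeasurable (1 / 2)
    (ae_of_all _ fun _ => abs_kernel_le _ _ _)

@[fun_prop]
lemma measurable_projection : Measurable (projection μ) := by
  have h : Measurable fun q : ℝ × (ℝ × ℝ) => kernel q.1 q.2.1 q.2.2 := by fun_prop
  exact h.stronglyMeasurable.integral_prod_right'.measurable

lemma abs_projection_le (s : ℝ) : |projection μ s| ≤ 1 / 2 := by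
  have h := norm_integral_le_of_norm_le_const (μ := μ.prod μ)
    (f := fun p : ℝ × ℝ => kernel s p.1 p.2) (ae_of_all _ fun _ => abs_kernel_le _ _ _)
  rw [projection]
  simpa using h

lemma integrable_projection_comp {β : Type*} [MeasurableSpace β] {ν : Measure β}
    [IsFiniteMeasure ν] {f : β → ℝ} (hf : Measurable f) :
    Integrable (fun b => projection μ (f b)) ν :=
  Integrable.of_bound (measurable_projection.comp hf).aestronglyMeasurable (1 / 2)
    (ae_of_all _ fun _ => abs_projection_le _)

/-- The kernel minus its first-order projections. -/
noncomputable def residualKernel (μ : Measure ℝ) (x y z : ℝ) : ℝ :=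
  kernel x y z - (projection μ x + projection μ y + projection μ z)

lemma abs_residualKernel_le (x y z : ℝ) : |residualKernel μ x y z| ≤ 2 := by
  have h := abs_le.1 (abs_kernel_le x y z)
  have h1 := abs_le.1 (abs_projection_le (μ := μ) x)
  have h2 := abs_le.1 (abs_projection_le (μ := μ) y)
  have h3 := abs_le.1 (abs_projection_le (μ := μ) z)
  rw [abs_le, residualKernel]
  constructor <;> linarith

/-- Integrating the kernel gives `projection μ x`, which the subtracted term in `x` removes; the
other two are centred by `h0`. -/
lemma integral_residualKernel (h0 : ∫ s, projection μ s ∂μ = 0) (x : ℝ) :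
    ∫ p : ℝ × ℝ, residualKernel μ x p.1 p.2 ∂(μ.prod μ) = 0 := by
  unfold residualKernel
  have hk := integrable_kernel (ν := μ.prod μ) (measurable_const (a := x)) measurable_fst
    measurable_snd
  have h1 := integrable_projection_comp (μ := μ) (ν := μ.prod μ) measurable_fst
  have h2 := integrable_projection_comp (μ := μ) (ν := μ.prod μ) measurable_snd
  rw [integral_sub hk (by exact ((integrable_const _).add h1).add h2),
    integral_add (by exact (integrable_const _).add h1) h2,
    integral_add (integrable_const _) h1, integral_fun_fst, integral_fun_snd, h0]
  simp [projection]

end Projection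

/-- The coefficient `3 / n` is the fraction of triples containing a given index. -/
lemma uStat_sub_projection_eq (μ : Measure ℝ) {n : ℕ} (hn : 3 ≤ n) (x : ℕ → ℝ) :
    uStat (fun i : Fin n => x i) - 3 / n * ∑ i ∈ Finset.range n, projection μ (x i)
      = (n.choose 3 : ℝ)⁻¹ *
        sumTriples n (fun i j k => residualKernel μ (x i) (x j) (x k)) := by
  have hpos : (n.choose 3 : ℝ) ≠ 0 := by
    exact_mod_cast (Nat.choose_pos hn).ne'
  have hn0 : (n : ℝ) ≠ 0 := by
    have : n ≠ 0 := by omega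
    exact_mod_cast this
  have hsplit : sumTriples n (fun i j k => kernel (x i) (x j) (x k))
      = sumTriples n (fun i j k => residualKernel μ (x i) (x j) (x k))
        + ((n : ℝ) - 1) * (n - 2) / 2 * ∑ i ∈ Finset.range n, projection μ (x i) := by
    rw [← sumTriples_add_marginals, ← sumTriples_add]
    simp [residualKernel]
  rw [uStat_eq, hsplit, mul_add, add_sub_assoc, add_eq_left, ← mul_assoc, sub_eq_zero]
  congr 1
  have hc := cast_choose_three n
  rw [inv_mul_eq_div, div_eq_div_iff hpos hn0, hc]
  ring

/-! ### Asymptotic equivalence and asymptotic normality -/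

section CentralLimit

variable {Ω : Type*} [MeasurableSpace Ω] {P : Measure Ω} {X : ℕ → Ω → ℝ}

lemma tendsto_sq_div_choose_three :
    Tendsto (fun n : ℕ => 108 * (n : ℝ) ^ 2 / n.choose 3) atTop (nhds 0) := by
  -- For `n ≥ 3` the estimates below give `C(n,3) ≥ n³/27`, so any constant from `108 · 27 = 2916`
  -- on would do.
  have hlim : Tendsto (fun n : ℕ => 3888 / (n : ℝ)) atTop (nhds 0) :=
    tendsto_const_div_atTop_nhds_zero_nat _
  refine squeeze_zero' (Eventually.of_forall fun n => by positivity) ?_ hlim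
  filter_upwards [eventually_ge_atTop 3] with n hn
  have hn' : (3 : ℝ) ≤ n := by exact_mod_cast hn
  have hpos : (0 : ℝ) < n.choose 3 := by exact_mod_cast Nat.choose_pos hn
  rw [div_le_div_iff₀ hpos (by linarith), cast_choose_three]
  have h1 : 2 * (n : ℝ) ≤ 3 * (n - 1) := by linarith
  have h2 : (n : ℝ) ≤ 3 * (n - 2) := by linarith
  have h3 : 2 * (n : ℝ) * n ≤ 3 * (n - 1) * (3 * (n - 2)) :=
    mul_le_mul h1 h2 (by linarith) (by linarith)
  have h4 := mul_le_mul_of_nonneg_left h3 (by linarith : (0 : ℝ) ≤ n)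
  have h5 : (0 : ℝ) ≤ n ^ 3 := by positivity
  nlinarith

lemma ae_one_le {α : ℝ} (hmeas : ∀ i, Measurable (X i))
    (hlaw : ∀ i, P.map (X i) = paretoMeasure 1 α) : ∀ᵐ ω ∂P, ∀ i, 1 ≤ X i ω :=
  ae_all_iff.2 fun i => ae_of_ae_map (hmeas i).aemeasurable
    (by rw [hlaw]; exact ae_one_le_paretoMeasure α)

lemma measurable_uStat (hmeas : ∀ i, Measurable (X i)) (n : ℕ) :
    Measurable fun ω => uStat (fun i : Fin n => X i ω) := by
  unfold uStat
  fun_prop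

lemma aemeasurable_testStat {α : ℝ} (hmeas : ∀ i, Measurable (X i))
    (hlaw : ∀ i, P.map (X i) = paretoMeasure 1 α) (n : ℕ) :
    AEMeasurable (fun ω => testStat (fun i : Fin n => X i ω)) P := by
  have hind : ∀ i k, Measurable fun ω => if X i ω ≤ X k ω then (1 : ℝ) else 0 := fun i k =>
    Measurable.ite (measurableSet_le (hmeas i) (hmeas k)) measurable_const measurable_const
  refine AEMeasurable.congr (f := fun ω => (n : ℝ)⁻¹ * ((n.choose 2 : ℝ)⁻¹ *
      ∑ k ∈ Finset.range n, sumPairs n (fun i j => ratioInd (X i ω) (X j ω) (X k ω))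
      - (n : ℝ)⁻¹ * ∑ k ∈ Finset.range n, ∑ i ∈ Finset.range n,
        if X i ω ≤ X k ω then (1 : ℝ) else 0)) (Measurable.aemeasurable ?_) ?_
  · unfold sumPairs
    fun_prop
  · filter_upwards [ae_one_le hmeas hlaw] with ω hω
    exact (testStat_eq_sum hω).symm

variable [IsProbabilityMeasure P]

lemma tendstoInMeasure_uStat_sub_projection {μ : Measure ℝ} [IsProbabilityMeasure μ]
    (hmeas : ∀ i, Measurable (X i)) (hlaw : ∀ i, P.map (X i) = μ) (hindep : iIndepFun X P)
    (h0 : ∫ s, projection μ s ∂μ = 0) :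
    TendstoInMeasure P
      (fun (n : ℕ) ω => √(n : ℝ) * uStat (fun i : Fin n => X i ω)
        - (√(n : ℝ))⁻¹ * ∑ k ∈ Finset.range n, 3 * projection μ (X k ω))
      atTop (fun _ => (0 : ℝ)) := by
  have hrew : ∀ n : ℕ, 3 ≤ n → ∀ ω, √(n : ℝ) * uStat (fun i : Fin n => X i ω)
        - (√(n : ℝ))⁻¹ * ∑ k ∈ Finset.range n, 3 * projection μ (X k ω)
      = √(n : ℝ) * ((n.choose 3 : ℝ)⁻¹ *
        sumTriples n (fun i j k => residualKernel μ (X i ω) (X j ω) (X k ω))) := by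
    intro n hn ω
    rw [← uStat_sub_projection_eq μ hn (fun i => X i ω), ← Finset.mul_sum]
    have hn0 : (0 : ℝ) < n := by
      have : 0 < n := by omega
      exact_mod_cast this
    have hs : √(n : ℝ) ^ 2 = n := Real.sq_sqrt hn0.le
    have hs0 : 0 < √(n : ℝ) := Real.sqrt_pos.2 hn0
    rw [mul_sub, sub_right_inj]
    nth_rw 3 [← hs]
    field_simp
  have hg : Measurable fun p : ℝ × ℝ × ℝ => residualKernel μ p.1 p.2.1 p.2.2 := by
    unfold residualKernel
    fun_prop
  have hsq : ∀ n : ℕ, Integrable (fun ω => (sumTriples n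
      fun i j k => residualKernel μ (X i ω) (X j ω) (X k ω)) ^ 2) P := by
    intro n
    simp_rw [sumTriples_eq_sum_triples]
    refine MemLp.integrable_sq (memLp_finsetSum _ fun t _ => ?_)
    exact MemLp.of_bound (hg.comp ((hmeas _).prodMk ((hmeas _).prodMk
      (hmeas _)))).aestronglyMeasurable 2 (ae_of_all _ fun ω => abs_residualKernel_le _ _ _)
  refine tendstoInMeasure_zero_of_integral_sq ?_ tendsto_sq_div_choose_three ?_
  · filter_upwards [eventually_ge_atTop 3] with n hn
    simp_rw [hrew n hn, mul_pow]
    exact ((hsq n).const_mul _).const_mul _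
  · filter_upwards [eventually_ge_atTop 3] with n hn
    have hpos : (0 : ℝ) < n.choose 3 := by exact_mod_cast Nat.choose_pos hn
    simp_rw [hrew n hn, mul_pow]
    rw [integral_const_mul, integral_const_mul, Real.sq_sqrt (Nat.cast_nonneg n)]
    have h := integral_sq_sumTriples_le hmeas hlaw hindep hg abs_residualKernel_le
      (integral_residualKernel h0)
      (fun x y z => by simp only [residualKernel, kernel_swap_left x y]; ring)
      (fun x y z => by simp only [residualKernel, kernel_swap_right x y]; ring) n
    calc (n : ℝ) * ((n.choose 3 : ℝ)⁻¹ ^ 2 * ∫ ω, (sumTriples n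
          fun i j k => residualKernel μ (X i ω) (X j ω) (X k ω)) ^ 2 ∂P)
        ≤ n * ((n.choose 3 : ℝ)⁻¹ ^ 2 * (n.choose 3 * (27 * n * 2 ^ 2))) := by gcongr
      _ = 108 * (n : ℝ) ^ 2 / n.choose 3 := by field_simp; norm_num

/-- Asymptotic normality of the first-order projection. -/
lemma tendstoInDistribution_projection {μ : Measure ℝ} [IsProbabilityMeasure μ]
    (hmeas : ∀ i, Measurable (X i)) (hlaw : ∀ i, P.map (X i) = μ) (hindep : iIndepFun X P)
    (h0 : ∫ s, projection μ s ∂μ = 0) {v : ℝ≥0}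
    (hv : 9 * Var[fun ω => projection μ (X 0 ω); P] = v) :
    TendstoInDistribution
      (fun (n : ℕ) ω => (√(n : ℝ))⁻¹ * ∑ k ∈ Finset.range n, 3 * projection μ (X k ω))
      atTop (id : ℝ → ℝ) (fun _ => P) (gaussianReal 0 v) := by
  have hpm : Measurable fun s => 3 * projection μ s := by fun_prop
  have hvar : Var[fun ω => 3 * projection μ (X 0 ω); P].toNNReal = v := by
    rw [variance_const_mul, show (3 : ℝ) ^ 2 = 9 by norm_num, hv, Real.toNNReal_coe]
  have hmean : ∫ ω, 3 * projection μ (X 0 ω) ∂P = 0 := by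
    rw [integral_const_mul, ← integral_map (hmeas 0).aemeasurable
      measurable_projection.aestronglyMeasurable, hlaw, h0, mul_zero]
  have hclt := tendstoInDistribution_inv_sqrt_mul_sum_sub (P := P) (P' := gaussianReal 0 v)
    (X := fun k ω => 3 * projection μ (X k ω)) (Y := (id : ℝ → ℝ))
    ⟨aemeasurable_id, by rw [Measure.map_id, hvar]⟩
    (MemLp.of_bound (hpm.comp (hmeas 0)).aestronglyMeasurable (3 / 2) (ae_of_all _ fun ω => by
      have := abs_projection_le (μ := μ) (X 0 ω)
      rw [Real.norm_eq_abs, abs_mul, abs_of_pos (by norm_num : (0 : ℝ) < 3)]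
      linarith))
    (hindep.comp (fun _ s => 3 * projection μ s) fun _ => hpm)
    (fun i => IdentDistrib.comp (f := X i) (g := X 0)
      ⟨(hmeas i).aemeasurable, (hmeas 0).aemeasurable, by rw [hlaw, hlaw]⟩ hpm)
  simpa only [hmean, mul_zero, sub_zero] using hclt

/-- The diagonal is null for `μ.prod μ`, since its slices are singletons; countably many pairs of
indices are then combined. -/
lemma ae_injective {μ : Measure ℝ} [IsProbabilityMeasure μ] [NullSingletonClass μ]
    (hmeas : ∀ i, Measurable (X i)) (hlaw : ∀ i, P.map (X i) = μ) (hindep : iIndepFun X P) :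
    ∀ᵐ ω ∂P, Function.Injective fun i => X i ω := by
  have h : ∀ᵐ ω ∂P, ∀ i j, i ≠ j → X i ω ≠ X j ω := by
    refine ae_all_iff.2 fun i => ae_all_iff.2 fun j => ?_
    by_cases hij : i = j
    · simp [hij]
    have hprod : ∀ᵐ p ∂(μ.prod μ), p.1 ≠ p.2 := by
      refine (Measure.ae_prod_iff_ae_ae ?_).2 (ae_of_all _ fun x => ?_)
      · exact (measurableSet_eq_fun measurable_fst measurable_snd).compl
      · rw [ae_iff]
        simp
    rw [← map_pair_eq_prod hmeas hlaw hindep hij] at hprod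
    filter_upwards [ae_of_ae_map ((hmeas i).prodMk (hmeas j)).aemeasurable hprod] with ω hω _
    exact hω
  filter_upwards [h] with ω hω i j hij
  by_contra hne
  exact hω i j hne hij

lemma tendstoInMeasure_testStat_sub_uStat {α : ℝ} (hα : 0 < α) (hmeas : ∀ i, Measurable (X i))
    (hlaw : ∀ i, P.map (X i) = paretoMeasure 1 α) (hindep : iIndepFun X P) :
    TendstoInMeasure P
      (fun (n : ℕ) ω => √(n : ℝ) * (testStat (fun i : Fin n => X i ω)
        - uStat (fun i : Fin n => X i ω)))
      atTop (fun _ => (0 : ℝ)) := by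
  have := isProbabilityMeasure_paretoMeasure (t := 1) one_pos hα
  have hu : Tendsto (fun n : ℕ => 3 / √(n : ℝ)) atTop (nhds 0) :=
    (Real.tendsto_sqrt_atTop.comp tendsto_natCast_atTop_atTop).const_div_atTop 3
  refine tendstoInMeasure_zero_of_abs_le hu ?_
  filter_upwards [eventually_ge_atTop 3] with n hn
  filter_upwards [ae_one_le hmeas hlaw, ae_injective hmeas hlaw hindep] with ω h1 h2
  have hn0 : (0 : ℝ) < n := by
    have : 0 < n := by omega
    exact_mod_cast this
  have hs0 : 0 < √(n : ℝ) := Real.sqrt_pos.2 hn0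
  rw [abs_mul, abs_of_pos hs0]
  have hb := abs_testStat_sub_uStat_le (x := fun i => X i ω) hn h1 h2
  calc √(n : ℝ) * |testStat (fun i : Fin n => X i ω) - uStat (fun i : Fin n => X i ω)|
      ≤ √(n : ℝ) * (3 / n) := by
        gcongr
    _ = 3 / √(n : ℝ) := by
        nth_rw 2 [← Real.sq_sqrt hn0.le]
        field_simp

/-- The projection evaluated at one observation is the conditional expectation of the kernel. -/
lemma condExp_kernel_ae_eq {μ : Measure ℝ} [IsProbabilityMeasure μ]
    (hmeas : ∀ i, Measurable (X i)) (hlaw : ∀ i, P.map (X i) = μ) (hindep : iIndepFun X P) :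
    P[fun ω => kernel (X 0 ω) (X 1 ω) (X 2 ω) | MeasurableSpace.comap (X 0) inferInstance]
      =ᵐ[P] fun ω => projection μ (X 0 ω) := by
  have hY : Measurable fun ω => (X 1 ω, X 2 ω) := by fun_prop
  have hind : IndepFun (X 0) (fun ω => (X 1 ω, X 2 ω)) P :=
    (hindep.indepFun_prodMk hmeas 1 2 0 (by norm_num) (by norm_num)).symm
  -- By independence, conditioning on `X 0` does not change the law of `(X 1, X 2)`.
  have hcond : condDistrib (fun ω => (X 1 ω, X 2 ω)) (X 0) P
      =ᵐ[P.map (X 0)] Kernel.const ℝ (μ.prod μ) := by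
    refine condDistrib_ae_eq_of_measure_eq_compProd _ hY.aemeasurable ?_
    rw [Measure.compProd_const, hind.map_prod_eq_prod_map_map (hmeas 0).aemeasurable
      hY.aemeasurable, map_pair_eq_prod hmeas hlaw hindep (by norm_num)]
  have hce := condExp_prod_ae_eq_integral_condDistrib (μ := P) (hmeas 0) hY.aemeasurable
    (f := fun q : ℝ × ℝ × ℝ => kernel q.1 q.2.1 q.2.2)
    (Measurable.stronglyMeasurable (by fun_prop))
    (integrable_kernel (hmeas 0) (hmeas 1) (hmeas 2))
  filter_upwards [hce, ae_of_ae_map (hmeas 0).aemeasurable hcond] with ω h1 h2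
  rw [h1, h2, Kernel.const_apply, projection]

end CentralLimit

end ParetoTest

theorem mainTheorem4 {Ω : Type*} [MeasurableSpace Ω] (P : Measure Ω) [IsProbabilityMeasure P]
    (α : ℝ) (hα : 0 < α) (X : ℕ → Ω → ℝ) (hmeas : ∀ i, Measurable (X i))
    (hlaw : ∀ i, P.map (X i) = paretoMeasure 1 α) (hindep : iIndepFun X P) :
    -- the projection is the conditional expectation of the kernel given one argument
    (P[fun ω => ParetoTest.kernel (X 0 ω) (X 1 ω) (X 2 ω) |
        MeasurableSpace.comap (X 0) inferInstance]
      =ᵐ[P] fun ω => ParetoTest.projection (paretoMeasure 1 α) (X 0 ω)) ∧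
    -- its explicit form
    (∀ s : ℝ, 1 ≤ s → ParetoTest.projection (paretoMeasure 1 α) s
      = 2 / 3 * (α * Real.log s / s ^ α) - 1 / 6) ∧
    -- it is centred, with variance `5/972`; in particular the kernel is non-degenerate
    (∫ ω, ParetoTest.projection (paretoMeasure 1 α) (X 0 ω) ∂P = 0) ∧
    Var[fun ω => ParetoTest.projection (paretoMeasure 1 α) (X 0 ω); P] = 5 / 972 ∧
    (∫ s in Set.Ioi (1 : ℝ),
      ParetoTest.projection (paretoMeasure 1 α) s ^ 2 * (α * s ^ (-α - 1)) = 5 / 972) ∧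
    0 < Var[fun ω => ParetoTest.projection (paretoMeasure 1 α) (X 0 ω); P] ∧
    -- asymptotic equivalence of the test statistic and the `U`-statistic of degree three
    TendstoInMeasure P
      (fun (n : ℕ) ω => √(n : ℝ) * (ParetoTest.testStat (fun i : Fin n => X i ω)
        - ParetoTest.uStat (fun i : Fin n => X i ω)))
      atTop (fun _ => (0 : ℝ)) ∧
    -- asymptotic normality
    TendstoInDistribution
      (fun (n : ℕ) ω => √(n : ℝ) * ParetoTest.testStat (fun i : Fin n => X i ω))
      atTop (id : ℝ → ℝ) (fun _ => P) (gaussianReal 0 (5 / 108)) := by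
  have hprob := isProbabilityMeasure_paretoMeasure (t := 1) one_pos hα
  have hpm := ParetoTest.measurable_projection (μ := paretoMeasure 1 α)
  have h0 := ParetoTest.integral_projection hα
  have hmean : ∫ ω, ParetoTest.projection (paretoMeasure 1 α) (X 0 ω) ∂P = 0 := by
    rw [← integral_map (hmeas 0).aemeasurable hpm.aestronglyMeasurable, hlaw, h0]
  have hvar : Var[fun ω => ParetoTest.projection (paretoMeasure 1 α) (X 0 ω); P] = 5 / 972 := by
    rw [variance_of_integral_eq_zero (by fun_prop) hmean,
      ← integral_map (f := fun s => ParetoTest.projection (paretoMeasure 1 α) s ^ 2)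
        (hmeas 0).aemeasurable (hpm.pow_const 2).aestronglyMeasurable, hlaw,
      ParetoTest.integral_paretoMeasure hα, ParetoTest.integral_projection_sq hα]
  have hTU := ParetoTest.tendstoInMeasure_testStat_sub_uStat hα hmeas hlaw hindep
  refine ⟨ParetoTest.condExp_kernel_ae_eq hmeas hlaw hindep,
    fun s hs => ParetoTest.projection_paretoMeasure hα hs, hmean, hvar,
    ParetoTest.integral_projection_sq hα, by rw [hvar]; norm_num, hTU, ?_⟩
  have hproj := ParetoTest.tendstoInDistribution_projection hmeas hlaw hindep h0 (v := 5 / 108)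
    (by rw [hvar]; norm_num)
  -- Slutsky's lemma is used twice: from the projection to the `U`-statistic, then on to the test
  -- statistic.
  have hU := tendstoInDistribution_of_tendstoInMeasure_sub
    (fun (n : ℕ) ω => √(n : ℝ) * ParetoTest.uStat (fun i : Fin n => X i ω)) _ hproj
    (ParetoTest.tendstoInMeasure_uStat_sub_projection hmeas hlaw hindep h0)
    (fun n => ((ParetoTest.measurable_uStat hmeas n).const_mul _).aemeasurable)
  refine tendstoInDistribution_of_tendstoInMeasure_sub _ _ hU ?_
    (fun n => (ParetoTest.aemeasurable_testStat hmeas hlaw n).const_mul _)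
  simp_rw [mul_sub] at hTU
  exact hTU
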